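/- **Model.** Finitely many servers $i$ have capacities $c_{i,r}\ge 0$ of finitely many resource types $r$. Finitely many users $n$ have weights $\phi_n>0$, demand vectors $d_n=(d_{n,r})_r$ with $d_{n,r}\ge 0$ and $d_n\ne 0$ (the resources needed per task), and placement indicators $\delta_{n,i}\in\{0,1\}$ ($\delta_{n,i}=1$ if tasks of $n$ may run on server $i$). Put $\gamma_{n,i}=\delta_{n,i}\min_{r:\,d_{n,r}>0} c_{i,r}/d_{n,r}$; server $i$ is *eligible* for $n$ if $\gamma_{n,i}>0$. An allocation consists of numbers $x_{n,i}\ge 0$ with $x_{n,i}=0$ if $i$ is not eligible for $n$; let $x_n=\sum_i x_{n,i}$, and let $s_{n,i}=x_n/\gamma_{n,i}$ (read as $+\infty$ if $\gamma_{n,i}=0$). It is feasible under RDM if $\sum_n x_{n,i}d_{n,r}\le c_{i,r}$ for all $i,r$, and feasible under TDM if $\sum_{n:\,\gamma_{n,i}>0} x_{n,i}/\gamma_{n,i}\le 1$ for all $i$. Under either regime, an allocation $x$ satisfies *PS-DSF* if it is feasible and, for every feasible $y$ and user $n$ with $y_n>x_n$, there are a user $m$ and a server $i$ with $y_{m,i}<x_{m,i}$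 and $s_{m,i}/\phi_m\le s_{n,i}/\phi_n$. The utility of user $n$ for resources $a=(a_{i,r})$ is the number of tasks it can run with them, $U_n(a)=\sum_i\delta_{n,i}\min_{r:\,d_{n,r}>0}a_{i,r}/d_{n,r}$; user $n$ receives $a_n=(x_{n,i}d_{n,r})_{i,r}$, so that $U_n(a_n)=x_n$. An allocation $x$ is *weighted max-min fair for resource $r$* if it is feasible and, for every feasible $y$ and user $n$ with $y_nd_{n,r}>x_nd_{n,r}$, there is a user $m$ with $y_md_{m,r}<x_md_{m,r}$ and $x_md_{m,r}/\phi_m\le x_nd_{n,r}/\phi_n$. **Theorem.** Every PS-DSF allocation $x$, under RDM as well as under TDM, satisfies: 1. *Single-resource fairness*: if there is only one resource type, $x$ is weighted max-min fair for it. 2. *Bottleneck fairness*: if a resource $r^*$ maximizes $d_{n,r}/c_{i,r}$ over $r$ (undemanded resources counting as $0$) for every user $n$ and every server $i$ eligible for $n$, then $x$ is weighted max-min fair for $r^*$. 3. *Envy-freeness*: $U_n(a_n)\ge U_n\bigl(\tfrac{\phi_n}{\phi_m}a_m\bigr)$ for all users $n,m$. 4. *Sharing incentive*: every user $n$ gets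 at least its utility from the portion $\phi_n/\sum_m\phi_m$ of the resources of every server, that is $x_n\ge\frac{\phi_n}{\sum_m\phi_m}\sum_i\gamma_{n,i}$. Under TDM, moreover: 5. *Pareto optimality*: for every PS-DSF allocation $x$, no feasible allocation $y$ has $y_m\ge x_m$ for all users $m$ and $y_n>x_n$ for some user $n$. 6. *Strategy-proofness*: let user $n$ declare any demand vector $d'_n$ (non-negative, non-zero) and any indicators $\delta'_{n,i}\in\{0,1\}$ in place of its true $d_n$, $\delta_{n,i}$, all else being equal. If $x$ is a PS-DSF allocation for the true declaration and $x'$ one for the misreport, then $U_n(a'_n)\le x_n$, where $a'_n=(x'_{n,i}d'_{n,r})_{i,r}$ and $U_n$ is computed with the true $d_n$ and $\delta_{n,i}$. -/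

import Mathlib

namespace PSDSF

/-- A cluster of heterogeneous servers `K` with resource types `R`, shared by the users `N`:
capacities `c i r`, per-task demands `d n r`, weights `φ n` and placement indicators `δ n i`.
Every user demands some resource. -/
structure System (N K R : Type*) where
  c : K → R → ℝ
  d : N → R → ℝ
  φ : N → ℝ
  δ : N → K → Bool
  c_nonneg : ∀ i r, 0 ≤ c i r
  d_nonneg : ∀ n r, 0 ≤ d n r
  d_ne_zero : ∀ n, ∃ r, 0 < d n r
  φ_pos : ∀ n, 0 < φ n

/-- The two feasibility regimes: resource division and time division multiplexing. -/
inductive Multiplexing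
  | RDM
  | TDM

/-- The number `min_r a_r / d_r` of tasks with demand vector `d` that the resource vector `a`
can run; a resource which is not demanded does not limit the number of tasks. -/
noncomputable def numTasks {R : Type*} (d a : R → ℝ) : ℝ :=
  ⨅ r : {r : R // 0 < d r}, a r / d r

/-- `x_n = ∑_i x_{n,i}`, the total number of tasks allocated to user `n`. -/
def total {N K : Type*} [Fintype K] (x : N → K → ℝ) (n : N) : ℝ := ∑ i, x n i

namespace System

variable {N K R : Type*}

/-- `γ_{n,i}`: the number of tasks user `n` can run when monopolizing server `i`. -/
noncomputable def γ (S : System N K R) (n : N) (i : K) : ℝ :=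
  if S.δ n i then numTasks (S.d n) (S.c i) else 0

/-- Server `i` is eligible to serve user `n`. -/
def Eligible (S : System N K R) (n : N) (i : K) : Prop := 0 < S.γ n i

/-- An allocation gives each user a non-negative number of tasks from each server, and none from
servers that are not eligible. -/
def IsAllocation (S : System N K R) (x : N → K → ℝ) : Prop :=
  (∀ n i, 0 ≤ x n i) ∧ ∀ n i, ¬ S.Eligible n i → x n i = 0

/-- Feasible allocations under either regime. -/
def Feasible [Fintype N] (S : System N K R) : Multiplexing → (N → K → ℝ) → Prop
  | .RDM, x => S.IsAllocation x ∧ ∀ i r, ∑ n, x n i * S.d n r ≤ S.c i r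
  | .TDM, x => S.IsAllocation x ∧ ∀ i, ∑ n, x n i / S.γ n i ≤ 1

/-- The virtual dominant share `s_{n,i} = x_n / γ_{n,i}` (meaningful for an eligible server). -/
noncomputable def vds [Fintype K] (S : System N K R) (x : N → K → ℝ) (n : N) (i : K) : ℝ :=
  total x n / S.γ n i

/-- Per-server dominant share fairness: `x` is feasible, and no `x_n` can be increased while
maintaining feasibility without decreasing some `x_{m,i}` with `s_{m,i}/φ_m ≤ s_{n,i}/φ_n`.
If server `i` is not eligible for `n`, then `γ_{n,i} = 0`, `s_{n,i}` is `+∞`, and the inequality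
holds; user `m` is eligible on server `i` because `x_{m,i} > 0`. -/
def IsPSDSF [Fintype N] [Fintype K] (S : System N K R) (μ : Multiplexing)
    (x : N → K → ℝ) : Prop :=
  S.Feasible μ x ∧ ∀ y, S.Feasible μ y → ∀ n, total x n < total y n →
    ∃ m i, y m i < x m i ∧
      (S.Eligible n i → S.vds x m i / S.φ m ≤ S.vds x n i / S.φ n)

/-- The resources `a_{n,i,r} = x_{n,i} d_{n,r}` that user `n` receives. -/
def bundle (S : System N K R) (x : N → K → ℝ) (n : N) : K → R → ℝ :=
  fun i r => x n i * S.d n r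

/-- The utilization of user `n` of the resources `a i r`: the number of tasks it can run with them.
Each task runs inside one server, and only on a server where the placement constraints of `n`
allow it. -/
noncomputable def utility [Fintype K] (S : System N K R) (n : N) (a : K → R → ℝ) : ℝ :=
  ∑ i, if S.δ n i then numTasks (S.d n) (a i) else 0

/-- Weighted max-min fairness with respect to resource `r`: the amount `a_{n,r} = x_n d_{n,r}`
of no user `n` can be increased while maintaining feasibility without decreasing `a_{m,r}` for
some user `m` with `a_{m,r}/φ_m ≤ a_{n,r}/φ_n`. -/
def MaxMinFair [Fintype N] [Fintype K] (S : System N K R) (μ : Multiplexing) (r : R)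
    (x : N → K → ℝ) : Prop :=
  S.Feasible μ x ∧ ∀ y, S.Feasible μ y → ∀ n, total x n * S.d n r < total y n * S.d n r →
    ∃ m, total y m * S.d m r < total x m * S.d m r ∧
      total x m * S.d m r / S.φ m ≤ total x n * S.d n r / S.φ n

/-- If there is only one resource type, the allocation is max-min fair. -/
def SingleResourceFair [Fintype N] [Fintype K] (S : System N K R) (μ : Multiplexing)
    (x : N → K → ℝ) : Prop :=
  ∀ r : R, (∀ r' : R, r' = r) → S.MaxMinFair μ r x

/-- Resource `r` maximizes `d_{n,r} / c_{i,r}`. On an eligible server every demanded resource has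
positive capacity, so the quotients with zero denominator are those of undemanded resources. -/
def IsDominant (S : System N K R) (n : N) (i : K) (r : R) : Prop :=
  ∀ r', S.d n r' / S.c i r' ≤ S.d n r / S.c i r

/-- If a resource is dominantly requested by every user from every eligible server, the
allocation is max-min fair with respect to it. -/
def BottleneckFair [Fintype N] [Fintype K] (S : System N K R) (μ : Multiplexing)
    (x : N → K → ℝ) : Prop :=
  ∀ r : R, (∀ n i, S.Eligible n i → S.IsDominant n i r) → S.MaxMinFair μ r x

/-- No user prefers the weight-adjusted resources of another user to its own. -/
def EnvyFree [Fintype K] (S : System N K R) (x : N → K → ℝ) : Prop :=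
  ∀ n m, S.utility n (fun i r => S.φ n / S.φ m * S.bundle x m i r) ≤
    S.utility n (S.bundle x n)

/-- Every user does at least as well as with the portion `φ_n / ∑_m φ_m` of every server. -/
def SharingIncentive [Fintype N] [Fintype K] (S : System N K R) (x : N → K → ℝ) : Prop :=
  ∀ n, S.utility n (fun i r => S.φ n / (∑ m, S.φ m) * S.c i r) ≤ S.utility n (S.bundle x n)

/-- No feasible allocation gives some user more tasks and no user fewer tasks. -/
def ParetoOptimal [Fintype N] [Fintype K] (S : System N K R) (μ : Multiplexing)
    (x : N → K → ℝ) : Prop :=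
  ∀ y, S.Feasible μ y → ∀ n, total x n < total y n → ∃ m, total y m < total x m

/-- `S'` arises from `S` when only user `n` changes what it declares: its demand vector and its
set of allowed servers. -/
def IsMisreport (S S' : System N K R) (n : N) : Prop :=
  S'.c = S.c ∧ S'.φ = S.φ ∧ ∀ m, m ≠ n → S'.d m = S.d m ∧ S'.δ m = S.δ m

/-- Strategy-proofness at the true system `S`: the resources that user `n` receives in any
outcome after a misreport, used for its true tasks on servers that can truly run them, do
not give more than what it gets from any outcome under its truthful report. -/
def StrategyProof [Fintype N] [Fintype K] (S : System N K R) (μ : Multiplexing) : Prop :=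
  ∀ (n : N) (S' : System N K R), S.IsMisreport S' n →
    ∀ x x', S.IsPSDSF μ x → S'.IsPSDSF μ x' →
      S.utility n (S'.bundle x' n) ≤ S.utility n (S.bundle x n)

end System

end PSDSF

/-!
Read the cluster as a market with linear utilities: server `i` is a good, `γ n i` is the number of
tasks that user `n` gets out of it, and `φ n` is the budget of `n`. Let user `n` pay `φ n / x_n`
per task, and let the price of a server be the money that it collects. Then `φ n / x_n * γ n i`,
which user `n` would pay for the whole server `i`, is the reciprocal of its weighted virtual
dominant share there.

Increasing `x n i` slightly at the expense of the users with a larger weighted share on `i` must be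
infeasible (`not_feasible_perturb`). So the users whose share is at most that of `n` exhaust
server `i`: for `RDM` in some resource that `n` demands (`exists_bottleneck`), for `TDM` in time.
Since a user's part of a resource never exceeds its part of the time, in either regime these users
take up at least the whole time of the server (`one_le_sum`). Four consequences:

* No user would pay more for a server than its price (`rate_mul_γ_le_price`). Summed over
  the servers, this is the sharing incentive, because at most `∑ m, φ m` is spent.
* A user `m` that gets on server `i` something useful to `n` would pay at least as much for the
  server as `n` would. With `numTasks (d n) (d m) * γ m i ≤ γ n i` this excludes envy on each of
  the servers.
* If `r` is dominant throughout, then shares of servers are shares of `r`, and the users whose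
  share of `r` is at most that of `n` fill all servers that any of them can use, so they cannot get
  more of `r` in total. This is max-min fairness. A single resource is trivially dominant.
* For `TDM`, users spend only where tasks are cheapest for them (`price_eq_of_pos`), that is, the
  allocation is a market equilibrium; it maximizes the total of the tasks at the rates
  `φ m / x_m` (`sum_rate_mul_total_le`), which gives Pareto optimality.

Linear markets are manipulable in general, but here a user only gets the resources of the tasks it
reports, each of which holds `ρ = numTasks (d n) (d' n)` true ones. So the misreport amounts to the
values `ρ * γ' n i ≤ γ n i` on the servers of use to `n`, and `n` can only lower them. Suppose that
the misreport pays, and that `n` then spends the fraction `k` of its budget on servers of use to it.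
The prices of these fall below `k` times the truthful ones. Let `D` be the set of all servers with
this property. Another user who truthfully buys in `D` finds its cheapest tasks only in `D` under
the misreport, and spends its budget there, while `n` spends there at least `k` times its budget.
So `D` collects at least `k` times the truthful amount, contrary to its definition.
-/

namespace PSDSF

/-! ### Task counts -/

section NumTasks

variable {R : Type*} {d d' a : R → ℝ}

theorem le_numTasks (hd : ∃ r, 0 < d r) {t : ℝ} (h : ∀ r, 0 < d r → t ≤ a r / d r) :
    t ≤ numTasks d a := by
  obtain ⟨r, hr⟩ := hd
  have : Nonempty {r : R // 0 < d r} := ⟨⟨r, hr⟩⟩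
  exact le_ciInf fun q => h q.1 q.2

theorem numTasks_nonneg (hd : ∃ r, 0 < d r) (ha : ∀ r, 0 ≤ a r) : 0 ≤ numTasks d a :=
  le_numTasks hd fun r hr => div_nonneg (ha r) hr.le

theorem numTasks_const_mul {t : ℝ} (ht : 0 ≤ t) :
    numTasks d (fun r => t * a r) = t * numTasks d a := by
  unfold numTasks
  rw [Real.mul_iInf_of_nonneg ht]
  simp only [mul_div_assoc]

theorem numTasks_self (hd : ∃ r, 0 < d r) : numTasks d d = 1 := by
  obtain ⟨r, hr⟩ := hd
  have : Nonempty {r : R // 0 < d r} := ⟨⟨r, hr⟩⟩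
  rw [numTasks, iInf_congr fun q : {r : R // 0 < d r} => div_self q.2.ne', ciInf_const]

variable [Finite R]

theorem numTasks_le {r : R} (hr : 0 < d r) : numTasks d a ≤ a r / d r :=
  ciInf_le (Set.finite_range _).bddBelow (⟨r, hr⟩ : {r : R // 0 < d r})

/-- The left-hand side counts the tasks with demand `d` that run inside the parcels `d'` which fit
into `a`. -/
theorem numTasks_mul_numTasks_le (hd : ∃ r, 0 < d r) (hd' : ∃ r, 0 < d' r)
    (hd0 : ∀ r, 0 ≤ d' r) (ha : ∀ r, 0 ≤ a r) :
    numTasks d d' * numTasks d' a ≤ numTasks d a := by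
  refine le_numTasks hd fun r hr => ?_
  have h₁ : numTasks d d' ≤ d' r / d r := numTasks_le hr
  rcases (hd0 r).lt_or_eq with h | h
  · calc numTasks d d' * numTasks d' a ≤ d' r / d r * (a r / d' r) :=
          mul_le_mul h₁ (numTasks_le h) (numTasks_nonneg hd' ha) (by positivity)
      _ = a r / d r := by field_simp
  · have h₂ : numTasks d d' = 0 :=
      le_antisymm (by simpa [← h] using h₁) (numTasks_nonneg hd hd0)
    rw [h₂, zero_mul]
    exact div_nonneg (ha r) hr.le

end NumTasks

namespace System

variable {N K R : Type*} {S : System N K R} {n m : N} {i : K}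

/-! ### Eligible servers -/

theorem Eligible.δ_eq (h : S.Eligible n i) : S.δ n i = true := by
  by_contra hn
  simp [Eligible, γ, hn] at h

theorem Eligible.γ_eq (h : S.Eligible n i) : S.γ n i = numTasks (S.d n) (S.c i) := by
  simp [γ, h.δ_eq]

theorem IsMisreport.γ_eq {S' : System N K R} (h : S.IsMisreport S' n) (hm : m ≠ n) (i : K) :
    S'.γ m i = S.γ m i := by
  obtain ⟨hc, -, ho⟩ := h
  rw [γ, γ, hc, (ho m hm).1, (ho m hm).2]

theorem γ_nonneg (S : System N K R) (n : N) (i : K) : 0 ≤ S.γ n i := by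
  unfold γ
  split_ifs
  · exact numTasks_nonneg (S.d_ne_zero n) (S.c_nonneg i)
  · exact le_rfl

section FiniteResources

variable [Finite R]

theorem γ_le (S : System N K R) (n : N) (i : K) {r : R} (hr : 0 < S.d n r) :
    S.γ n i ≤ S.c i r / S.d n r := by
  unfold γ
  split_ifs
  · exact numTasks_le hr
  · exact div_nonneg (S.c_nonneg i r) hr.le

theorem Eligible.c_pos (h : S.Eligible n i) {r : R} (hr : 0 < S.d n r) : 0 < S.c i r :=
  (div_pos_iff_of_pos_right hr).1 (lt_of_lt_of_le h (S.γ_le n i hr))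

theorem Eligible.dominant_pos {r : R} (h : S.Eligible n i) (hr : S.IsDominant n i r) :
    0 < S.d n r ∧ 0 < S.c i r := by
  obtain ⟨q, hq⟩ := S.d_ne_zero n
  have hpos : 0 < S.d n r / S.c i r := (div_pos hq (h.c_pos hq)).trans_le (hr q)
  have hd : 0 < S.d n r := (S.d_nonneg n r).lt_of_ne fun h0 => by simp [← h0] at hpos
  exact ⟨hd, h.c_pos hd⟩

theorem Eligible.γ_eq_of_isDominant {r : R} (h : S.Eligible n i) (hr : S.IsDominant n i r) :
    S.γ n i = S.c i r / S.d n r := by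
  obtain ⟨hd, hc⟩ := h.dominant_pos hr
  refine le_antisymm (S.γ_le n i hd) ?_
  rw [h.γ_eq]
  refine le_numTasks (S.d_ne_zero n) fun q hq => ?_
  have := hr q
  rw [div_le_div_iff₀ (h.c_pos hq) hc] at this
  rw [div_le_div_iff₀ hd hq]
  linarith

end FiniteResources

/-! ### Feasible allocations -/

variable {μ : Multiplexing} {x y : N → K → ℝ}

section Users

variable [Fintype N]

theorem Feasible.isAllocation (h : S.Feasible μ x) : S.IsAllocation x := by
  cases μ <;> exact h.1

theorem Feasible.nonneg (h : S.Feasible μ x) (n : N) (i : K) : 0 ≤ x n i :=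
  h.isAllocation.1 n i

theorem Feasible.eligible (h : S.Feasible μ x) (hx : 0 < x n i) : S.Eligible n i := by
  by_contra hn
  exact hx.ne' (h.isAllocation.2 n i hn)

theorem Feasible.div_γ_eq [Finite R] {r : R} (h : S.Feasible μ x)
    (hr : ∀ n i, S.Eligible n i → S.IsDominant n i r) (m : N) (i : K) :
    x m i / S.γ m i = x m i * S.d m r / S.c i r := by
  rcases (h.nonneg m i).lt_or_eq with hx | hx
  · have hm := h.eligible hx
    rw [hm.γ_eq_of_isDominant (hr m i hm), div_div_eq_mul_div]
  · simp [← hx]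

end Users

variable [Fintype K]

theorem exists_pos_of_total_pos (hx : 0 < total x n) : ∃ i, 0 < x n i := by
  by_contra! hn
  exact hx.not_ge (Finset.sum_nonpos fun i _ => hn i)

variable [Fintype N]

theorem Feasible.total_nonneg (h : S.Feasible μ x) (n : N) : 0 ≤ total x n :=
  Finset.sum_nonneg fun i _ => h.nonneg n i

theorem Feasible.le_total (h : S.Feasible μ x) (n : N) (i : K) : x n i ≤ total x n :=
  Finset.single_le_sum (fun j _ => h.nonneg n j) (Finset.mem_univ i)

theorem Feasible.total_pos (h : S.Feasible μ x) (hx : 0 < x n i) : 0 < total x n :=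
  hx.trans_le (h.le_total n i)

theorem utility_bundle (h : S.Feasible μ x) (n : N) :
    S.utility n (S.bundle x n) = total x n := by
  refine Finset.sum_congr rfl fun i _ => ?_
  split_ifs with hδ
  · exact (numTasks_const_mul (h.nonneg n i)).trans (by rw [numTasks_self (S.d_ne_zero n), mul_one])
  · by_contra hne
    exact hδ (h.eligible ((h.nonneg n i).lt_of_ne hne)).δ_eq

/-- Each task of the reported kind holds `numTasks (S.d n) (S'.d n)` true tasks, provided that it is
on a server which `n` can truly use. -/
theorem utility_misreport {S' : System N K R} {x' : N → K → ℝ} (h : S'.Feasible μ x') (n : N) :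
    S.utility n (S'.bundle x' n) =
      numTasks (S.d n) (S'.d n) * ∑ i with S.δ n i, x' n i := by
  rw [utility, Finset.sum_filter, Finset.mul_sum]
  refine Finset.sum_congr rfl fun i _ => ?_
  split_ifs
  · exact (numTasks_const_mul (h.nonneg n i)).trans (mul_comm _ _)
  · simp

/-! ### Money per task and prices -/

/-- The money user `m` pays per task, `φ_m / x_m`, so that its budget is `φ_m`; it is `0` for a
user that runs no task. -/
noncomputable def rate (S : System N K R) (x : N → K → ℝ) (m : N) : ℝ := S.φ m / total x m

omit [Fintype N] in
theorem rate_pos (S : System N K R) (hx : 0 < total x m) : 0 < S.rate x m :=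
  div_pos (S.φ_pos m) hx

omit [Fintype N] in
theorem rate_mul_total (S : System N K R) (hx : 0 < total x m) :
    S.rate x m * total x m = S.φ m :=
  div_mul_cancel₀ _ hx.ne'

omit [Fintype N] in
/-- Weighted virtual dominant shares are reciprocals of `rate x m * γ m i`, the money that user
`m` would pay for the whole server `i`. -/
theorem rate_mul_γ_le (hm : S.Eligible m i) (hn : S.Eligible n i) (hxm : 0 < total x m)
    (hxn : 0 < total x n) (h : S.vds x m i / S.φ m ≤ S.vds x n i / S.φ n) :
    S.rate x n * S.γ n i ≤ S.rate x m * S.γ m i := by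
  have hγm : 0 < S.γ m i := hm
  have hγn : 0 < S.γ n i := hn
  have hφm := S.φ_pos m
  have hφn := S.φ_pos n
  simp only [vds, div_div] at h
  rw [div_le_div_iff₀ (by positivity) (by positivity)] at h
  simp only [rate, div_mul_eq_mul_div]
  rw [div_le_div_iff₀ hxn hxm]
  linarith

/-- The price of server `i`: the money that all users pay for their tasks there. -/
noncomputable def price (S : System N K R) (x : N → K → ℝ) (i : K) : ℝ :=
  ∑ m, S.rate x m * x m i

theorem Feasible.rate_nonneg (h : S.Feasible μ x) (m : N) : 0 ≤ S.rate x m :=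
  div_nonneg (S.φ_pos m).le (h.total_nonneg m)

theorem Feasible.price_nonneg (h : S.Feasible μ x) (i : K) : 0 ≤ S.price x i :=
  Finset.sum_nonneg fun m _ => mul_nonneg (h.rate_nonneg m) (h.nonneg m i)

theorem Feasible.rate_mul_total_le (h : S.Feasible μ x) (m : N) :
    S.rate x m * total x m ≤ S.φ m := by
  rcases (h.total_nonneg m).lt_or_eq with hx | hx
  · exact (S.rate_mul_total hx).le
  · rw [← hx, mul_zero]; exact (S.φ_pos m).le

theorem sum_price (S : System N K R) (x : N → K → ℝ) :
    ∑ i, S.price x i = ∑ m, S.rate x m * total x m := by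
  simp only [price, total, Finset.mul_sum]
  exact Finset.sum_comm

/-! ### Perturbations and bottlenecks -/

open Classical in
/-- The change of `x` which tests the fairness of `x` at user `n` and server `i`: on server `i`,
user `n` gets `ε` more tasks, and the users with a weighted virtual dominant share larger than
that of `n` get nothing. -/
noncomputable def perturb (S : System N K R) (x : N → K → ℝ) (n : N) (i : K) (ε : ℝ) :
    N → K → ℝ := fun m j =>
  if j = i then
    (if S.vds x m i / S.φ m ≤ S.vds x n i / S.φ n then x m i else 0) + if m = n then ε else 0
  else x m j

omit [Fintype N] in
theorem isAllocation_perturb (h : S.IsAllocation x) (hn : S.Eligible n i) {ε : ℝ}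
    (hε : 0 < ε) : S.IsAllocation (S.perturb x n i ε) := by
  constructor
  · intro m j
    unfold perturb
    have := h.1 m i
    have := h.1 m j
    split_ifs <;> linarith
  · intro m j hm
    unfold perturb
    have h0 := h.2 m j hm
    by_cases hj : j = i
    · subst hj
      have : m ≠ n := by rintro rfl; exact hm hn
      simp [this, h0]
    · simp [hj, h0]

open Classical in
/-- The load on server `i` after `perturb`, if a task of user `m` causes the load `g m`. -/
theorem sum_perturb (S : System N K R) (x : N → K → ℝ) (n : N) (i : K) (ε : ℝ) (g : N → ℝ) :
    ∑ m, S.perturb x n i ε m i * g m =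
      (∑ m with S.vds x m i / S.φ m ≤ S.vds x n i / S.φ n, x m i * g m) + ε * g n := by
  simp [perturb, add_mul, Finset.sum_add_distrib, Finset.sum_filter, ite_mul]

theorem IsPSDSF.not_feasible_perturb (h : S.IsPSDSF μ x) (hn : S.Eligible n i) {ε : ℝ}
    (hε : 0 < ε) : ¬ S.Feasible μ (S.perturb x n i ε) := by
  classical
  intro hf
  -- Only users with a larger share lose anything, and only on server `i`.
  obtain ⟨m, j, hlt, hle⟩ := h.2 _ hf n (by
    refine Finset.sum_lt_sum (fun j _ => ?_) ⟨i, Finset.mem_univ i, ?_⟩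
    · by_cases hj : j = i
      · subst hj; simpa [perturb] using hε.le
      · simp [perturb, hj]
    · simpa [perturb] using hε)
  by_cases hj : j = i
  · subst hj
    have h0 : (0 : ℝ) ≤ if m = n then ε else 0 := by split_ifs <;> linarith
    simp only [perturb, if_true, if_pos (hle hn)] at hlt
    linarith
  · simp [perturb, hj] at hlt

variable [Fintype R]

/-- Under resource division, some resource that `n` demands is exhausted, on each server eligible
for `n`, by users whose weighted virtual dominant share is at most that of `n`. -/
theorem IsPSDSF.exists_bottleneck (h : S.IsPSDSF .RDM x) (hn : S.Eligible n i) :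
    ∃ r, 0 < S.d n r ∧
      S.c i r ≤ ∑ m with S.vds x m i / S.φ m ≤ S.vds x n i / S.φ n, x m i * S.d m r := by
  by_contra! hc
  have hev : ∀ᶠ ε in nhdsWithin (0 : ℝ) (Set.Ioi 0), ∀ r,
      (∑ m with S.vds x m i / S.φ m ≤ S.vds x n i / S.φ n, x m i * S.d m r) + ε * S.d n r
        ≤ S.c i r := by
    rw [Filter.eventually_all]
    intro r
    rcases (S.d_nonneg n r).lt_or_eq with hr | hr
    · have ht : Filter.Tendsto (fun ε : ℝ =>
          (∑ m with S.vds x m i / S.φ m ≤ S.vds x n i / S.φ n, x m i * S.d m r) + ε * S.d n r)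
          (nhdsWithin 0 (Set.Ioi 0)) (nhds
          ((∑ m with S.vds x m i / S.φ m ≤ S.vds x n i / S.φ n, x m i * S.d m r)
            + 0 * S.d n r)) :=
        (Continuous.tendsto (by fun_prop) 0).mono_left nhdsWithin_le_nhds
      rw [zero_mul, add_zero] at ht
      exact (ht.eventually_lt_const (hc r hr)).mono fun _ => le_of_lt
    · refine Filter.Eventually.of_forall fun ε => ?_
      rw [← hr, mul_zero, add_zero]
      refine le_trans (Finset.sum_le_sum_of_subset_of_nonneg (Finset.filter_subset _ _)
        fun m _ _ => mul_nonneg (h.1.nonneg m i) (S.d_nonneg m r)) (h.1.2 i r)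
  obtain ⟨ε, hle, hε⟩ := (hev.and self_mem_nhdsWithin).exists
  refine h.not_feasible_perturb hn hε ⟨isAllocation_perturb h.1.isAllocation hn hε, fun j r => ?_⟩
  by_cases hj : j = i
  · subst hj
    rw [sum_perturb]
    exact hle r
  · simpa [perturb, hj] using h.1.2 j r

/-- On a server eligible for `n`, the users whose weighted virtual dominant share is at most
that of `n` take up, in units of what each could run there alone, the whole server. -/
theorem IsPSDSF.one_le_sum (h : S.IsPSDSF μ x) (hn : S.Eligible n i) :
    1 ≤ ∑ m with S.vds x m i / S.φ m ≤ S.vds x n i / S.φ n, x m i / S.γ m i := by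
  cases μ with
  | RDM =>
    obtain ⟨r, hr, hle⟩ := h.exists_bottleneck hn
    have hc := hn.c_pos hr
    rw [← div_self hc.ne']
    refine (div_le_div_of_nonneg_right hle hc.le).trans ?_
    rw [Finset.sum_div]
    refine Finset.sum_le_sum fun m _ => ?_
    rcases (h.1.nonneg m i).lt_or_eq with hx | hx
    · have hγ : 0 < S.γ m i := h.1.eligible hx
      rcases (S.d_nonneg m r).lt_or_eq with hd | hd
      · have := (le_div_iff₀ hd).1 (S.γ_le m i hd)
        rw [div_le_div_iff₀ hc hγ, mul_assoc]
        gcongr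
        linarith
      · rw [← hd]; simp only [mul_zero, zero_div]; positivity
    · simp [← hx]
  | TDM =>
    by_contra! hc
    -- The idle time `1 - s` can go to `n`.
    set s := ∑ m with S.vds x m i / S.φ m ≤ S.vds x n i / S.φ n, x m i / S.γ m i with hs
    have hγ : 0 < S.γ n i := hn
    have hε : 0 < (1 - s) * S.γ n i := mul_pos (by linarith) hγ
    refine h.not_feasible_perturb hn hε
      ⟨isAllocation_perturb h.1.isAllocation hn hε, fun j => ?_⟩
    by_cases hj : j = i
    · subst hj
      have := S.sum_perturb x n j ((1 - s) * S.γ n j) fun m => (S.γ m j)⁻¹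
      simp only [← div_eq_mul_inv] at this
      rw [this, ← hs, mul_div_assoc, div_self hγ.ne']
      linarith
    · simpa [perturb, hj] using h.1.2 j

/-- A server is worked on only by users whose weighted virtual dominant share there is minimal. -/
theorem IsPSDSF.vds_le_of_pos (h : S.IsPSDSF .TDM x) (hn : S.Eligible n i) (hx : 0 < x m i) :
    S.vds x m i / S.φ m ≤ S.vds x n i / S.φ n := by
  by_contra hm
  have hγ : 0 < S.γ m i := h.1.eligible hx
  have h1 := h.one_le_sum hn
  have h2 := Finset.sum_lt_sum_of_subset (Finset.filter_subset
      (fun m => S.vds x m i / S.φ m ≤ S.vds x n i / S.φ n) Finset.univ)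
    (Finset.mem_univ m) (by simpa using hm) (div_pos hx hγ)
    fun k _ _ => div_nonneg (h.1.nonneg k i) (S.γ_nonneg k i)
  linarith [h.1.2 i]

theorem IsPSDSF.total_pos_of_eligible (h : S.IsPSDSF μ x) (hn : S.Eligible n i) :
    0 < total x n := by
  refine (h.1.total_nonneg n).lt_of_ne fun h0 => ?_
  have h1 := h.one_le_sum hn
  rw [Finset.sum_eq_zero] at h1
  · linarith
  intro m hm
  by_contra hne
  have hx : 0 < x m i := (h.1.nonneg m i).lt_of_ne fun h => hne (by simp [← h])
  have hγ : 0 < S.γ m i := h.1.eligible hx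
  have hpos : 0 < S.vds x m i / S.φ m := div_pos (div_pos (h.1.total_pos hx) hγ) (S.φ_pos m)
  have := (Finset.mem_filter.1 hm).2
  simp only [vds, ← h0, zero_div] at this hpos
  linarith

/-! ### Prices in fair allocations -/

/-- No user would pay more for a server than its price. -/
theorem IsPSDSF.rate_mul_γ_le_price (h : S.IsPSDSF μ x) (n : N) (i : K) :
    S.rate x n * S.γ n i ≤ S.price x i := by
  by_cases hn : S.Eligible n i
  · have hxn := h.total_pos_of_eligible hn
    have hγn : 0 < S.γ n i := hn
    have hr := S.rate_pos hxn
    calc S.rate x n * S.γ n i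
        ≤ S.rate x n * S.γ n i *
          ∑ m with S.vds x m i / S.φ m ≤ S.vds x n i / S.φ n, x m i / S.γ m i :=
          le_mul_of_one_le_right (by positivity) (h.one_le_sum hn)
      _ ≤ ∑ m with S.vds x m i / S.φ m ≤ S.vds x n i / S.φ n, S.rate x m * x m i := by
          rw [Finset.mul_sum]
          refine Finset.sum_le_sum fun m hm => ?_
          rcases (h.1.nonneg m i).lt_or_eq with hx | hx
          · have hm' : S.Eligible m i := h.1.eligible hx
            have hγ : 0 < S.γ m i := hm'
            have := rate_mul_γ_le hm' hn (h.1.total_pos hx) hxn (Finset.mem_filter.1 hm).2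
            rw [← mul_div_assoc, div_le_iff₀ hγ]
            nlinarith
          · simp [← hx]
      _ ≤ S.price x i :=
          Finset.sum_le_sum_of_subset_of_nonneg (Finset.filter_subset _ _)
            fun m _ _ => mul_nonneg (h.1.rate_nonneg m) (h.1.nonneg m i)
  · have : S.γ n i = 0 := le_antisymm (not_lt.1 hn) (S.γ_nonneg n i)
    rw [this, mul_zero]
    exact h.1.price_nonneg i

/-- Under time division, every user spends its money only where a task is cheapest for it. -/
theorem IsPSDSF.price_eq_of_pos (h : S.IsPSDSF .TDM x) (hx : 0 < x m i) :
    S.price x i = S.rate x m * S.γ m i := by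
  refine le_antisymm ?_ (h.rate_mul_γ_le_price m i)
  have hm := h.1.eligible hx
  have hm0 : 0 ≤ S.rate x m * S.γ m i := mul_nonneg (h.1.rate_nonneg m) (S.γ_nonneg m i)
  calc S.price x i ≤ ∑ k, S.rate x m * S.γ m i * (x k i / S.γ k i) := by
        refine Finset.sum_le_sum fun k _ => ?_
        rcases (h.1.nonneg k i).lt_or_eq with hk | hk
        · have hk' := h.1.eligible hk
          have hγ : 0 < S.γ k i := hk'
          have := rate_mul_γ_le hm hk' (h.1.total_pos hx) (h.1.total_pos hk)
            (h.vds_le_of_pos hk' hx)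
          rw [← mul_div_assoc, le_div_iff₀ hγ]
          nlinarith
        · simp [← hk]
    _ = S.rate x m * S.γ m i * ∑ k, x k i / S.γ k i := by rw [Finset.mul_sum]
    _ ≤ S.rate x m * S.γ m i := mul_le_of_le_one_right hm0 (h.1.2 i)

/-! ### Sharing incentive and envy-freeness -/

theorem IsPSDSF.sharingIncentive (h : S.IsPSDSF μ x) : S.SharingIncentive x := by
  intro n
  have hΦ : 0 < ∑ m, S.φ m :=
    Finset.sum_pos (fun m _ => S.φ_pos m) ⟨n, Finset.mem_univ n⟩
  have hu : S.utility n (fun i r => S.φ n / (∑ m, S.φ m) * S.c i r) =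
      S.φ n / (∑ m, S.φ m) * ∑ i, S.γ n i := by
    simp only [utility, γ, Finset.mul_sum]
    refine Finset.sum_congr rfl fun i _ => ?_
    split_ifs
    · exact numTasks_const_mul (div_nonneg (S.φ_pos n).le hΦ.le)
    · simp
  rw [hu, utility_bundle h.1]
  by_cases hn : ∃ i, S.Eligible n i
  · obtain ⟨i, hi⟩ := hn
    have hx := h.total_pos_of_eligible hi
    have key : S.rate x n * ∑ i, S.γ n i ≤ ∑ m, S.φ m := by
      rw [Finset.mul_sum]
      calc ∑ i, S.rate x n * S.γ n i ≤ ∑ i, S.price x i :=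
            Finset.sum_le_sum fun i _ => h.rate_mul_γ_le_price n i
        _ = ∑ m, S.rate x m * total x m := S.sum_price x
        _ ≤ ∑ m, S.φ m := Finset.sum_le_sum fun m _ => h.1.rate_mul_total_le m
    rw [rate, div_mul_eq_mul_div, div_le_iff₀ hx] at key
    rw [div_mul_eq_mul_div, div_le_iff₀ hΦ]
    linarith
  · push Not at hn
    rw [Finset.sum_eq_zero fun i _ => le_antisymm (not_lt.1 (hn i)) (S.γ_nonneg n i), mul_zero]
    exact h.1.total_nonneg n

/-- If `n` has any use for what `m` gets on server `i`, then the weighted virtual dominant share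
of `m` there is at most that of `n`. -/
theorem IsPSDSF.vds_le_of_numTasks_pos (h : S.IsPSDSF μ x) (hn : S.Eligible n i)
    (hx : 0 < x m i) (hd : 0 < numTasks (S.d n) (S.d m)) :
    S.vds x m i / S.φ m ≤ S.vds x n i / S.φ n := by
  cases μ with
  | TDM => exact h.vds_le_of_pos hn hx
  | RDM =>
    obtain ⟨r, hr, hle⟩ := h.exists_bottleneck hn
    by_contra hm
    have hdm : 0 < S.d m r := (div_pos_iff_of_pos_right hr).1 (hd.trans_le (numTasks_le hr))
    have h2 := Finset.sum_lt_sum_of_subset (Finset.filter_subset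
        (fun m => S.vds x m i / S.φ m ≤ S.vds x n i / S.φ n) Finset.univ)
      (Finset.mem_univ m) (by simpa using hm) (mul_pos hx hdm)
      fun k _ _ => mul_nonneg (h.1.nonneg k i) (S.d_nonneg k r)
    linarith [h.1.2 i r]

theorem IsPSDSF.envyFree (h : S.IsPSDSF μ x) : S.EnvyFree x := by
  intro n m
  rw [utility_bundle h.1]
  have hφn := S.φ_pos n
  have hφm := S.φ_pos m
  have hρ := numTasks_nonneg (S.d_ne_zero n) (S.d_nonneg m)
  have hterm : ∀ i, (if S.δ n i then
      numTasks (S.d n) (fun r => S.φ n / S.φ m * S.bundle x m i r) else 0) ≤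
      x m i * (total x n / total x m) := by
    intro i
    have h0 : 0 ≤ x m i * (total x n / total x m) :=
      mul_nonneg (h.1.nonneg m i) (div_nonneg (h.1.total_nonneg n) (h.1.total_nonneg m))
    split_ifs with hδ
    · have : (fun r => S.φ n / S.φ m * S.bundle x m i r) =
          fun r => (S.φ n / S.φ m * x m i) * S.d m r := by
        funext r; simp only [bundle]; ring
      rw [this, numTasks_const_mul (mul_nonneg (by positivity) (h.1.nonneg m i))]
      rcases (h.1.nonneg m i).lt_or_eq with hx | hx
      swap
      · simp [← hx]
      rcases hρ.lt_or_eq with hρ | hρ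
      swap
      · simpa [← hρ] using h0
      have hm := h.1.eligible hx
      have hγm : 0 < S.γ m i := hm
      have hγ : numTasks (S.d n) (S.d m) * S.γ m i ≤ S.γ n i := by
        rw [hm.γ_eq, γ, if_pos hδ]
        exact numTasks_mul_numTasks_le (S.d_ne_zero n) (S.d_ne_zero m) (S.d_nonneg m)
          (S.c_nonneg i)
      have hn : S.Eligible n i := (mul_pos hρ hγm).trans_le hγ
      have hxm := h.1.total_pos hx
      have hxn := h.total_pos_of_eligible hn
      have hle := rate_mul_γ_le hm hn hxm hxn (h.vds_le_of_numTasks_pos hn hx hρ)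
      have h1 : S.rate x n * numTasks (S.d n) (S.d m) ≤ S.rate x m := by
        refine le_of_mul_le_mul_right ?_ hγm
        have := mul_le_mul_of_nonneg_left hγ (h.1.rate_nonneg n)
        linarith
      rw [rate, rate, div_mul_eq_mul_div, div_le_div_iff₀ hxn hxm] at h1
      have h2 : S.φ n / S.φ m * numTasks (S.d n) (S.d m) ≤ total x n / total x m := by
        rw [div_mul_eq_mul_div, div_le_div_iff₀ hφm hxm]
        linarith
      calc S.φ n / S.φ m * x m i * numTasks (S.d n) (S.d m)
          = x m i * (S.φ n / S.φ m * numTasks (S.d n) (S.d m)) := by ring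
        _ ≤ _ := mul_le_mul_of_nonneg_left h2 hx.le
    · exact h0
  calc _ ≤ ∑ i, x m i * (total x n / total x m) := Finset.sum_le_sum fun i _ => hterm i
    _ = total x m * (total x n / total x m) := by rw [← Finset.sum_mul]; rfl
    _ ≤ total x n := by
        rcases (h.1.total_nonneg m).lt_or_eq with hx | hx
        · rw [mul_div_cancel₀ _ hx.ne']
        · rw [← hx, zero_mul]; exact h.1.total_nonneg n

/-! ### Fairness with respect to one resource -/

omit [Fintype K] in
theorem Feasible.sum_mul_le_capacity {r : R} (h : S.Feasible μ x)
    (hr : ∀ n i, S.Eligible n i → S.IsDominant n i r) (i : K) :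
    ∑ m, x m i * S.d m r ≤ S.c i r := by
  cases μ with
  | RDM => exact h.2 i r
  | TDM =>
    rcases (S.c_nonneg i r).lt_or_eq with hc | hc
    · have := h.2 i
      rw [Finset.sum_congr rfl fun m _ => h.div_γ_eq hr m i, ← Finset.sum_div,
        div_le_one hc] at this
      exact this
    · refine (Finset.sum_nonpos fun m _ => ?_).trans hc.le
      rcases (h.nonneg m i).lt_or_eq with hx | hx
      · have hm := h.eligible hx
        exact absurd hc (hm.dominant_pos (hr m i hm)).2.ne
      · simp [← hx]

/-- If `r` is dominant throughout, each server eligible for `n` is filled by the users whose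
weighted share of `r` is at most that of `n`. -/
theorem IsPSDSF.capacity_le_sum {r : R} (h : S.IsPSDSF μ x)
    (hr : ∀ n i, S.Eligible n i → S.IsDominant n i r) (hn : S.Eligible n i) :
    S.c i r ≤ ∑ m with total x m * S.d m r / S.φ m ≤ total x n * S.d n r / S.φ n,
      x m i * S.d m r := by
  have hc := (hn.dominant_pos (hr n i hn)).2
  have h1 := h.one_le_sum hn
  rw [Finset.sum_congr rfl fun m _ => h.1.div_γ_eq hr m i, ← Finset.sum_div,
    one_le_div hc] at h1
  refine h1.trans ?_
  rw [Finset.sum_filter, Finset.sum_filter]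
  refine Finset.sum_le_sum fun m _ => ?_
  rcases (h.1.nonneg m i).lt_or_eq with hx | hx
  · have hm := h.1.eligible hx
    have e : ∀ k, S.Eligible k i →
        S.vds x k i / S.φ k = total x k * S.d k r / S.φ k / S.c i r := by
      intro k hk
      rw [vds, hk.γ_eq_of_isDominant (hr k i hk), div_div_eq_mul_div, div_right_comm]
    simp only [e m hm, e n hn, div_le_div_iff_of_pos_right hc, le_refl]
  · simp [← hx]

theorem IsPSDSF.bottleneckFair (h : S.IsPSDSF μ x) : S.BottleneckFair μ x := by
  classical
  intro r hr
  refine ⟨h.1, fun y hy n hlt => ?_⟩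
  by_contra! hc
  set L : Finset N :=
    {m | total x m * S.d m r / S.φ m ≤ total x n * S.d n r / S.φ n} with hL
  have hnL : n ∈ L := by simp [hL]
  have hxy : ∑ m ∈ L, total x m * S.d m r < ∑ m ∈ L, total y m * S.d m r := by
    refine Finset.sum_lt_sum (fun m hm => ?_) ⟨n, hnL, hlt⟩
    by_contra! hm'
    exact (hc m hm').not_ge (Finset.mem_filter.1 hm).2
  have hswap : ∀ z : N → K → ℝ, ∑ m ∈ L, total z m * S.d m r =
      ∑ i, ∑ m ∈ L, z m i * S.d m r := by
    intro z
    simp only [total, Finset.sum_mul]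
    exact Finset.sum_comm
  rw [hswap, hswap] at hxy
  refine hxy.not_ge (Finset.sum_le_sum fun i _ => ?_)
  by_cases hi : ∃ m ∈ L, S.Eligible m i
  · -- Server `i` is filled by `L`, so `L` cannot get more from it under `y`.
    obtain ⟨m, hm, hmi⟩ := hi
    calc ∑ m ∈ L, y m i * S.d m r ≤ ∑ m, y m i * S.d m r :=
          Finset.sum_le_sum_of_subset_of_nonneg (Finset.subset_univ _)
            fun k _ _ => mul_nonneg (hy.nonneg k i) (S.d_nonneg k r)
      _ ≤ S.c i r := hy.sum_mul_le_capacity hr i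
      _ ≤ _ := h.capacity_le_sum hr hmi
      _ ≤ ∑ m ∈ L, x m i * S.d m r :=
          Finset.sum_le_sum_of_subset_of_nonneg
            (fun k hk => by
              simp only [hL, Finset.mem_filter, Finset.mem_univ, true_and] at hk hm ⊢
              exact hk.trans hm)
            fun k _ _ => mul_nonneg (h.1.nonneg k i) (S.d_nonneg k r)
  · push Not at hi
    refine Finset.sum_le_sum fun m hm => ?_
    rw [hy.isAllocation.2 m i (hi m hm), h.1.isAllocation.2 m i (hi m hm)]

theorem IsPSDSF.singleResourceFair (h : S.IsPSDSF μ x) : S.SingleResourceFair μ x :=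
  fun r hr => h.bottleneckFair r fun _ _ _ r' => by rw [hr r']

/-! ### Pareto optimality -/

/-- A fair allocation maximizes the total number of tasks weighted by what users pay per task. -/
theorem IsPSDSF.sum_rate_mul_total_le (h : S.IsPSDSF .TDM x) (hy : S.Feasible .TDM y) :
    ∑ m, S.rate x m * total y m ≤ ∑ m, S.rate x m * total x m := by
  rw [← S.sum_price x]
  have hswap : ∑ m, S.rate x m * total y m = ∑ i, ∑ m, S.rate x m * y m i := by
    simp only [total, Finset.mul_sum]
    exact Finset.sum_comm
  rw [hswap]
  refine Finset.sum_le_sum fun i _ => ?_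
  calc ∑ m, S.rate x m * y m i ≤ ∑ m, S.price x i * (y m i / S.γ m i) := by
        refine Finset.sum_le_sum fun m _ => ?_
        rcases (hy.nonneg m i).lt_or_eq with hm | hm
        · have hγ : 0 < S.γ m i := hy.eligible hm
          rw [← mul_div_assoc, le_div_iff₀ hγ]
          have := mul_le_mul_of_nonneg_right (h.rate_mul_γ_le_price m i) hm.le
          linarith
        · simp [← hm]
    _ = S.price x i * ∑ m, y m i / S.γ m i := by rw [Finset.mul_sum]
    _ ≤ S.price x i := mul_le_of_le_one_right (h.1.price_nonneg i) (hy.2 i)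

theorem IsPSDSF.paretoOptimal (h : S.IsPSDSF .TDM x) : S.ParetoOptimal .TDM x := by
  intro y hy n hn
  by_contra! hle
  obtain ⟨i, hi⟩ := exists_pos_of_total_pos ((h.1.total_nonneg n).trans_lt hn)
  have hr := S.rate_pos (h.total_pos_of_eligible (hy.eligible hi))
  refine (h.sum_rate_mul_total_le hy).not_gt
    (Finset.sum_lt_sum (fun m _ => ?_) ⟨n, Finset.mem_univ n, ?_⟩)
  · exact mul_le_mul_of_nonneg_left (hle m) (h.1.rate_nonneg m)
  · exact mul_lt_mul_of_pos_left hn hr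

/-! ### Strategy-proofness -/

theorem strategyProof_TDM (S : System N K R) : S.StrategyProof .TDM := by
  classical
  intro n S' hS x x' h h'
  rw [utility_bundle h.1, utility_misreport h'.1]
  set ρ := numTasks (S.d n) (S'.d n) with hρdef
  set g := ∑ i with S.δ n i, x' n i with hgdef
  by_contra! hlt
  have hρ0 : 0 ≤ ρ := numTasks_nonneg (S.d_ne_zero n) (S'.d_nonneg n)
  have hg0 : 0 ≤ g := Finset.sum_nonneg fun i _ => h'.1.nonneg n i
  have hpos : 0 < ρ * g := (h.1.total_nonneg n).trans_lt hlt
  have hρ : 0 < ρ := hρ0.lt_of_ne fun h => by simp [← h] at hpos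
  have hg : 0 < g := hg0.lt_of_ne fun h => by simp [← h] at hpos
  have hγ : ∀ i, S.δ n i → 0 < x' n i → ρ * S'.γ n i ≤ S.γ n i := by
    intro i hδ hx
    rw [(h'.1.eligible hx).γ_eq, γ, if_pos hδ, hS.1]
    exact numTasks_mul_numTasks_le (S.d_ne_zero n) (S'.d_ne_zero n) (S'.d_nonneg n)
      (S.c_nonneg i)
  -- Under the misreport, `n` gets something on a server that its tasks can truly use.
  obtain ⟨i₀, hi₀, hx₀⟩ : ∃ i, S.δ n i ∧ 0 < x' n i := by
    by_contra! hc
    exact hg.not_ge (Finset.sum_nonpos fun i hi => hc i (Finset.mem_filter.1 hi).2)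
  have hγ' : 0 < S'.γ n i₀ := h'.1.eligible hx₀
  have hx := h.total_pos_of_eligible ((mul_pos hρ hγ').trans_le (hγ i₀ hi₀ hx₀))
  have hx' := h'.1.total_pos hx₀
  have hw := S.rate_pos hx
  have hφn := S.φ_pos n
  -- The fraction of its budget that `n` spends on such servers.
  set k := g / total x' n with hkdef
  have hk : 0 < k := div_pos hg hx'
  have hk1 : k ≤ 1 := by
    rw [hkdef, div_le_one hx']
    exact Finset.sum_le_sum_of_subset_of_nonneg (Finset.filter_subset _ _)
      fun i _ _ => h'.1.nonneg n i
  have hkw : S'.rate x' n < k * (ρ * S.rate x n) := by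
    rw [rate, rate, hS.2.1, hkdef]
    rw [show g / total x' n * (ρ * (S.φ n / total x n)) =
      (S.φ n / total x' n) * (ρ * g / total x n) by ring]
    exact lt_mul_of_one_lt_right (by positivity) ((one_lt_div hx).2 hlt)
  set D : Finset K := {i | S'.price x' i < k * S.price x i} with hD
  have hmemD : ∀ i, i ∈ D ↔ S'.price x' i < k * S.price x i := by simp [hD]
  have hDn : ∀ i, S.δ n i → 0 < x' n i → i ∈ D := by
    intro i hδ hxi
    have hγi : 0 < S'.γ n i := h'.1.eligible hxi
    rw [hmemD, h'.price_eq_of_pos hxi]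
    calc S'.rate x' n * S'.γ n i < k * (ρ * S.rate x n) * S'.γ n i :=
          mul_lt_mul_of_pos_right hkw hγi
      _ = k * (S.rate x n * (ρ * S'.γ n i)) := by ring
      _ ≤ k * (S.rate x n * S.γ n i) := by gcongr; exact hγ i hδ hxi
      _ ≤ k * S.price x i := by gcongr; exact h.rate_mul_γ_le_price n i
  -- Whoever else buys in `D` under the truth spends its whole budget in `D` under the misreport.
  have hDm : ∀ m, m ≠ n → ∀ i ∈ D, 0 < x m i → ∀ j, 0 < x' m j → j ∈ D := by
    intro m hm i hi hxi j hxj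
    rw [hmemD] at hi ⊢
    have hγi : 0 < S.γ m i := h.1.eligible hxi
    have hγj : 0 < S.γ m j := by rw [← hS.γ_eq hm j]; exact h'.1.eligible hxj
    have hwm : S'.rate x' m < k * S.rate x m := by
      refine lt_of_mul_lt_mul_right ?_ hγi.le
      calc S'.rate x' m * S.γ m i ≤ S'.price x' i := by
            rw [← hS.γ_eq hm i]; exact h'.rate_mul_γ_le_price m i
        _ < k * S.price x i := hi
        _ = k * S.rate x m * S.γ m i := by rw [h.price_eq_of_pos hxi, mul_assoc]
    calc S'.price x' j = S'.rate x' m * S.γ m j := by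
          rw [h'.price_eq_of_pos hxj, hS.γ_eq hm j]
      _ < k * S.rate x m * S.γ m j := mul_lt_mul_of_pos_right hwm hγj
      _ = k * (S.rate x m * S.γ m j) := by ring
      _ ≤ k * S.price x j := by gcongr; exact h.rate_mul_γ_le_price m j
  have hspend : ∀ m, k * ∑ i ∈ D, S.rate x m * x m i ≤ ∑ i ∈ D, S'.rate x' m * x' m i := by
    intro m
    have hle : ∑ i ∈ D, S.rate x m * x m i ≤ S.φ m := by
      refine le_trans ?_ (h.1.rate_mul_total_le m)
      rw [total, Finset.mul_sum]
      exact Finset.sum_le_sum_of_subset_of_nonneg (Finset.subset_univ _)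
        fun i _ _ => mul_nonneg (h.1.rate_nonneg m) (h.1.nonneg m i)
    have hnn : ∀ i, 0 ≤ S'.rate x' m * x' m i :=
      fun i => mul_nonneg (h'.1.rate_nonneg m) (h'.1.nonneg m i)
    by_cases hm : m = n
    · subst hm
      calc k * ∑ i ∈ D, S.rate x m * x m i ≤ k * S.φ m := by gcongr
        _ = S'.rate x' m * g := by rw [rate, hS.2.1, hkdef]; ring
        _ = ∑ i with S.δ m i, S'.rate x' m * x' m i := by rw [hgdef, Finset.mul_sum]
        _ ≤ ∑ i ∈ D, S'.rate x' m * x' m i := by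
            rw [← Finset.sum_filter_ne_zero]
            refine Finset.sum_le_sum_of_subset_of_nonneg (fun i hi => ?_) fun i _ _ => hnn i
            simp only [Finset.mem_filter, Finset.mem_univ, true_and] at hi
            exact hDn i hi.1 ((h'.1.nonneg m i).lt_of_ne fun h0 => hi.2 (by simp [← h0]))
    · by_cases hb : ∃ i ∈ D, 0 < x m i
      · obtain ⟨i, hi, hxi⟩ := hb
        have helig : S'.Eligible m i := by
          rw [Eligible, hS.γ_eq hm i]; exact h.1.eligible hxi
        calc k * ∑ i ∈ D, S.rate x m * x m i ≤ 1 * S.φ m := by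
              gcongr
              exact Finset.sum_nonneg fun i _ => mul_nonneg (h.1.rate_nonneg m) (h.1.nonneg m i)
          _ = S'.rate x' m * total x' m := by
              rw [S'.rate_mul_total (h'.total_pos_of_eligible helig), hS.2.1, one_mul]
          _ = ∑ j, S'.rate x' m * x' m j := by rw [total, Finset.mul_sum]
          _ = ∑ j ∈ D, S'.rate x' m * x' m j := by
              refine (Finset.sum_subset (Finset.subset_univ _) fun j _ hj => ?_).symm
              by_contra hne
              exact hj (hDm m hm i hi hxi j
                ((h'.1.nonneg m j).lt_of_ne fun h0 => hne (by simp [← h0])))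
      · push Not at hb
        rw [Finset.sum_eq_zero fun i hi => by
          rw [le_antisymm (hb i hi) (h.1.nonneg m i), mul_zero], mul_zero]
        exact Finset.sum_nonneg fun i _ => hnn i
  -- `D` collects at least `k` times the truthful amount, but each of its prices is below that.
  have h1 : ∑ i ∈ D, S'.price x' i < ∑ i ∈ D, k * S.price x i :=
    Finset.sum_lt_sum_of_nonempty ⟨i₀, hDn i₀ hi₀ hx₀⟩ fun i hi => (hmemD i).1 hi
  have h2 : ∑ i ∈ D, k * S.price x i ≤ ∑ i ∈ D, S'.price x' i := by
    rw [← Finset.mul_sum]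
    simp only [price]
    rw [Finset.sum_comm, Finset.mul_sum, Finset.sum_comm (s := D)]
    exact Finset.sum_le_sum fun m _ => hspend m
  exact h1.not_ge h2

end System

end PSDSF

theorem theorem3 {N K R : Type*} [Fintype N] [Fintype K] [Fintype R]
    (S : PSDSF.System N K R) :
    (∀ (μ : PSDSF.Multiplexing) (x : N → K → ℝ), S.IsPSDSF μ x →
      S.SingleResourceFair μ x ∧ S.BottleneckFair μ x ∧ S.EnvyFree x ∧ S.SharingIncentive x) ∧
    (∀ x : N → K → ℝ, S.IsPSDSF .TDM x → S.ParetoOptimal .TDM x) ∧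
    S.StrategyProof .TDM :=
  ⟨fun _ _ h => ⟨h.singleResourceFair, h.bottleneckFair, h.envyFree, h.sharingIncentive⟩,
    fun _ h => h.paretoOptimal, S.strategyProof_TDM⟩
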